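/- Let $d\ge 2$. Put $\Omega=\mathbb{R}^d\times\mathbb{S}^{d-1}$, $T\mathbb{S}^{d-1}=\{(x,\theta)\in\Omega : x\cdot\theta=0\}$ and $r(x,\theta)=|x-(x\cdot\theta)\theta|$ for $(x,\theta)\in\Omega$ (the distance from the origin to the line through $x$ with direction $\theta$). For functions $W$ on $\Omega$ and $f$ on $\mathbb{R}^d$ the weighted ray transform is $$P_Wf(x,\theta)=\int_{\mathbb{R}}W(x+t\theta,\theta)\,f(x+t\theta)\,dt,\qquad (x,\theta)\in T\mathbb{S}^{d-1}.$$ There exist a real-valued weight $W\in L^\infty(\Omega)$ with $W\ge c$ for some constant $c>0$, and a non-zero function $f\in C_0^\infty(\mathbb{R}^d)$, such that $$P_Wf\equiv 0\quad\text{on } T\mathbb{S}^{d-1}.$$ In addition, $f$ is spherically symmetric (it depends only on $|x|$) and $\operatorname{supp} f\subseteq\{|x|\le 1\}$, and $W$ is rotation invariant, that is, $$W(x,\theta)=U(r(x,\theta),\,x\cdot\theta),\qquad (x,\theta)\in\Omega,$$ for some positive continuous function $U$ on $\mathbb{R}\times\mathbb{R}$ with $U(a,b)=U(-a,b)=U(a,-b)$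 for all $a,b\in\mathbb{R}$. Moreover: 1. $W$ is $C^\infty$ on $\{(x,\theta)\in\Omega : r(x,\theta)\ne 1\}$; 2. $W\in C^\alpha(\Omega)$ for every $\alpha\in(0,1/16)$, that is, $W$ is bounded and $$\sup\Big\{\frac{|W(y_1)-W(y_2)|}{|y_1-y_2|^\alpha} : y_1,y_2\in\Omega,\ 0<|y_1-y_2|\le 1\Big\}<\infty,$$ where $|\cdot|$ is the Euclidean norm of $\mathbb{R}^d\times\mathbb{R}^d\supset\Omega$; 3. $W\ge 1/2$ on $\Omega$, and $W(x,\theta)=1$ whenever $r(x,\theta)\ge 1$; 4. there is a constant $R>1$ such that $W(x,\theta)=1$ for all $|x|\ge R$ and $\theta\in\mathbb{S}^{d-1}$. -/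

import Mathlib

open MeasureTheory Metric
open scoped ContDiff Manifold RealInnerProductSpace

namespace WeightedRay

/-- Euclidean space `ℝ^d`. -/
abbrev E (d : ℕ) : Type := EuclideanSpace ℝ (Fin d)

/-- The unit sphere `S^{d-1}` of `ℝ^d`. -/
abbrev S (d : ℕ) : Type := sphere (0 : E d) 1

/-- `Ω = ℝ^d × S^{d-1}`. -/
abbrev Om (d : ℕ) : Type := E d × S d

/-- `TS^{d-1}`, the pairs `(x, θ) ∈ ℝ^d × S^{d-1}` with `x θ = 0`; it parametrizes the oriented
lines of `ℝ^d`. -/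
def TS (d : ℕ) : Set (Om d) := {p | ⟪p.1, (p.2 : E d)⟫ = 0}

/-- The distance `r(x, θ) = |x - (x θ) θ|` from the origin to the line through `x` with
direction `θ`. -/
noncomputable def r {d : ℕ} (p : Om d) : ℝ :=
  ‖p.1 - ⟪p.1, (p.2 : E d)⟫ • (p.2 : E d)‖

/-- `Ω(Λ)`, the set of all `(x, θ) ∈ Ω` with `r(x, θ) ∈ Λ`. -/
def OmSet (d : ℕ) (L : Set ℝ) : Set (Om d) := {p | r p ∈ L}

/-- The weighted ray transform `P_W f (x, θ) = ∫ W(x + t θ, θ) f(x + t θ) dt`. -/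
noncomputable def rayTransform {d : ℕ} (W : Om d → ℝ) (f : E d → ℝ) (p : Om d) : ℝ :=
  ∫ t : ℝ, W (p.1 + t • (p.2 : E d), p.2) * f (p.1 + t • (p.2 : E d))

/-- Real weights which are bounded below by a positive constant and belong to `L^∞(Ω)`, where `Ω`
carries the product of Lebesgue measure and surface measure. -/
def IsWeight {d : ℕ} (W : Om d → ℝ) : Prop :=
  (∃ c : ℝ, 0 < c ∧ ∀ p, c ≤ W p) ∧
    MemLp W ⊤ ((volume : Measure (E d)).prod (volume : Measure (E d)).toSphere)

/-- Rotation invariance: `W(x, θ) = U(|x - (x θ) θ|, x θ)` with `U` positive, continuous on `ℝ × ℝ`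
and even in each variable. -/
def IsRotationInvariant {d : ℕ} (W : Om d → ℝ) : Prop :=
  ∃ U : ℝ × ℝ → ℝ, Continuous U ∧ (∀ q, 0 < U q) ∧
    (∀ a b : ℝ, U (a, b) = U (-a, b) ∧ U (a, b) = U (a, -b)) ∧
    ∀ p : Om d, W p = U (r p, ⟪p.1, (p.2 : E d)⟫)

/-- `f` depends on `|x|` only. -/
def IsSphericallySymmetric {d : ℕ} (f : E d → ℝ) : Prop :=
  ∃ g : ℝ → ℝ, ∀ x, f x = g ‖x‖

theorem fact_finrank {d : ℕ} (hd : 2 ≤ d) : Fact (Module.finrank ℝ (E d) = (d - 1) + 1) :=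
  ⟨by rw [finrank_euclideanSpace_fin]; omega⟩

/-- `W` is infinitely smooth on the subset `A` of the manifold `Ω = ℝ^d × S^{d-1}`. -/
def IsSmoothOn {d : ℕ} (hd : 2 ≤ d) (W : Om d → ℝ) (A : Set (Om d)) : Prop :=
  haveI := fact_finrank hd
  ContMDiffOn (𝓘(ℝ, E d).prod (𝓡 (d - 1))) 𝓘(ℝ, ℝ) ∞ W A

/-- The distance of two points of `Ω`, as a subset of the Euclidean space `ℝ^d × ℝ^d`. -/
noncomputable def eucDist {d : ℕ} (p q : Om d) : ℝ :=
  Real.sqrt (‖p.1 - q.1‖ ^ 2 + ‖(p.2 : E d) - (q.2 : E d)‖ ^ 2)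

/-- `W ∈ C^α(Ω)`: the norm `sup |W| + sup |W p - W q| / |p - q| ^ α`, the second supremum over
the pairs with `0 < |p - q| ≤ 1`, is finite. -/
def IsHolder {d : ℕ} (α : ℝ) (W : Om d → ℝ) : Prop :=
  (∃ M : ℝ, ∀ p, |W p| ≤ M) ∧
    ∃ C : ℝ, ∀ p q, eucDist p q ≤ 1 → |W p - W q| ≤ C * eucDist p q ^ α

end WeightedRay

namespace WeightedRay

/-! Take a radial function `f = k(|x|²)` and look for a weight `W = 1 - k(|x|²) Q(r²)`. On a line at
squared distance `u` from the origin `r` is constant and `|x|² = u + t²`, so `P_W f = F(u) - Q(u)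
H(u)`, where `F` and `H` are the chord integrals of `k` and `k²`. The choice `Q = F / H` annihilates
`f`; what remains is to choose `k` so that the correction `k Q` is at most 1/2 and Hölder continuous
up to `r = 1`, where both integrals degenerate.

Write `y = 1 - u` and `J = exp(-1/y)`. The profile `k` is essentially `exp(-1/z) cos(freq z⁻³)` with
`z = 1 - v`. Its fast oscillation makes `F` small, of order `y² J` (`abs_chordIntegral_profile_le`),
while `cos²` averages to 1/2, so `H` is at least of order `y J²` (`chordIntegral_profile_sq_ge`).
Hence `|Q| ≤ y / (4 J)`, and since `|k| ≤ 2 J` on the chord, `|k Q| ≤ y / 2` (`abs_correction_le`).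

This bound gives positivity, and continuity at `r = 1`. The derivatives of `k` and `Q` lose only
powers of `1/y` beyond the factors `J` and `1/J`, which cancel in the product; balancing these
powers against the decay `y / 2` yields Hölder exponent 1/8 (`exists_abs_correction_sub_le_of_le`).
-/

/-- The frequency parameter of the oscillating radial profile. -/
noncomputable def freq : ℝ := 409600

/-! ### Flat oscillating functions -/

/-- The flat oscillating function `z ↦ z⁻ⁿ exp (-1/z) exp (i freq z⁻³)`, extended by zero to
`z ≤ 0`. -/
noncomputable def flatOsc (n : ℕ) (z : ℝ) : ℂ :=
  ((z⁻¹ ^ n * expNegInvGlue z : ℝ) : ℂ) * Complex.exp (((freq * z⁻¹ ^ 3 : ℝ) : ℂ) * Complex.I)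

theorem flatOsc_of_nonpos (n : ℕ) {z : ℝ} (hz : z ≤ 0) : flatOsc n z = 0 := by
  simp [flatOsc, expNegInvGlue.zero_of_nonpos hz]

theorem norm_flatOsc (n : ℕ) (z : ℝ) : ‖flatOsc n z‖ = |z⁻¹ ^ n * expNegInvGlue z| := by
  rw [flatOsc, norm_mul, Complex.norm_exp_ofReal_mul_I, mul_one, Complex.norm_real,
    Real.norm_eq_abs]

theorem tendsto_flatOsc_zero (n : ℕ) : Filter.Tendsto (flatOsc n) (nhds 0) (nhds 0) := by
  rw [tendsto_zero_iff_norm_tendsto_zero]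
  have h := expNegInvGlue.tendsto_polynomial_inv_mul_zero (Polynomial.X ^ n)
  simp only [Polynomial.eval_pow, Polynomial.eval_X] at h
  simpa [norm_flatOsc] using h.abs

theorem hasDerivAt_flatOsc (n : ℕ) (z : ℝ) :
    HasDerivAt (flatOsc n) (-(n : ℂ) * flatOsc (n + 1) z + flatOsc (n + 2) z
      - 3 * (freq : ℂ) * Complex.I * flatOsc (n + 4) z) z := by
  rcases lt_trichotomy z 0 with hz | rfl | hz
  · simp only [flatOsc_of_nonpos _ hz.le, mul_zero, add_zero, sub_zero]
    refine (hasDerivAt_const z (0 : ℂ)).congr_of_eventuallyEq ?_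
    filter_upwards [gt_mem_nhds hz] with y hy
    rw [flatOsc_of_nonpos _ hy.le]
  · simp only [flatOsc_of_nonpos _ le_rfl, mul_zero, add_zero, sub_zero]
    rw [hasDerivAt_iff_tendsto_slope]
    -- The difference quotient of `flatOsc n` at 0 is exactly `flatOsc (n + 1)`, which tends to 0.
    refine ((tendsto_flatOsc_zero (n + 1)).mono_left inf_le_left).congr fun x ↦ ?_
    simp only [slope, sub_zero, vsub_eq_sub, flatOsc_of_nonpos _ le_rfl]
    simp only [flatOsc, Complex.real_smul]
    push_cast
    ring
  · have h1 : HasDerivAt (fun x : ℝ ↦ x⁻¹ ^ n * expNegInvGlue x)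
        ((-(n : ℝ) * z⁻¹ ^ (n + 1) + z⁻¹ ^ (n + 2)) * expNegInvGlue z) z := by
      have := expNegInvGlue.hasDerivAt_polynomial_eval_inv_mul (Polynomial.X ^ n) z
      simp only [Polynomial.eval_pow, Polynomial.eval_X] at this
      convert! this using 1
      rcases n with _ | n
      · simp
      · simp [-mul_eq_mul_right_iff]
        ring
    have h2 : HasDerivAt (fun x : ℝ ↦ freq * x⁻¹ ^ 3) (-3 * freq * z⁻¹ ^ 4) z := by
      convert! ((hasDerivAt_inv hz.ne').pow 3).const_mul freq using 1
      push_cast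
      field_simp
    convert! h1.ofReal_comp.mul (h2.ofReal_comp.mul_const Complex.I).cexp using 1
    simp only [flatOsc]
    push_cast
    ring

/-- The family is closed under differentiation up to linear combinations, so induction over all `n`
at once applies. -/
theorem contDiff_flatOsc (n : ℕ) : ContDiff ℝ ∞ (flatOsc n) := by
  refine contDiff_infty.2 fun m ↦ ?_
  induction m generalizing n with
  | zero =>
    exact contDiff_zero.2
      (continuous_iff_continuousAt.2 fun z ↦ (hasDerivAt_flatOsc n z).continuousAt)
  | succ m ihm =>
    rw [show ((m + 1 : ℕ) : WithTop ℕ∞) = m + 1 from rfl]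
    refine contDiff_succ_iff_deriv.2
      ⟨fun z ↦ (hasDerivAt_flatOsc n z).differentiableAt, by simp, ?_⟩
    rw [show deriv (flatOsc n) = _ from funext fun z ↦ (hasDerivAt_flatOsc n z).deriv]
    exact ((contDiff_const.mul (ihm _)).add (ihm _)).sub (contDiff_const.mul (ihm _))

/-- `exp (-1/z) cos (freq z⁻³)`. -/
noncomputable def flatCos (z : ℝ) : ℝ := expNegInvGlue z * Real.cos (freq * z⁻¹ ^ 3)

/-- `exp (-1/z) sin (freq z⁻³)`. -/
noncomputable def flatSin (z : ℝ) : ℝ := expNegInvGlue z * Real.sin (freq * z⁻¹ ^ 3)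

theorem flatOsc_re (n : ℕ) (z : ℝ) : (flatOsc n z).re = z⁻¹ ^ n * flatCos z := by
  rw [flatOsc, Complex.re_ofReal_mul, Complex.exp_ofReal_mul_I_re, flatCos, mul_assoc]

theorem flatOsc_im (n : ℕ) (z : ℝ) : (flatOsc n z).im = z⁻¹ ^ n * flatSin z := by
  rw [flatOsc, Complex.im_ofReal_mul, Complex.exp_ofReal_mul_I_im, flatSin, mul_assoc]

theorem contDiff_flatCos : ContDiff ℝ ∞ flatCos := by
  have : flatCos = fun z ↦ Complex.reCLM (flatOsc 0 z) := by
    ext z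
    simp [flatOsc_re]
  rw [this]
  exact Complex.reCLM.contDiff.comp (contDiff_flatOsc 0)

theorem contDiff_flatSin : ContDiff ℝ ∞ flatSin := by
  have : flatSin = fun z ↦ Complex.imCLM (flatOsc 0 z) := by
    ext z
    simp [flatOsc_im]
  rw [this]
  exact Complex.imCLM.contDiff.comp (contDiff_flatOsc 0)

theorem hasDerivAt_flatCos (z : ℝ) :
    HasDerivAt flatCos (z⁻¹ ^ 2 * flatCos z + 3 * freq * z⁻¹ ^ 4 * flatSin z) z := by
  have h := Complex.reCLM.hasFDerivAt.comp_hasDerivAt z (hasDerivAt_flatOsc 0 z)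
  convert! h using 1
  · ext w
    simp [flatOsc_re]
  · simp [flatOsc_re, flatOsc_im]
    ring

theorem hasDerivAt_flatSin (z : ℝ) :
    HasDerivAt flatSin (z⁻¹ ^ 2 * flatSin z - 3 * freq * z⁻¹ ^ 4 * flatCos z) z := by
  have h := Complex.imCLM.hasFDerivAt.comp_hasDerivAt z (hasDerivAt_flatOsc 0 z)
  convert! h using 1
  · ext w
    simp [flatOsc_im]
  · simp [flatOsc_re, flatOsc_im]
    ring

/-! ### The radial profile: primitive and size bounds -/

/-- The radial profile, as a function of `v = |x|²`. -/
noncomputable def profile (v : ℝ) : ℝ :=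
  flatCos (1 - v) - (4 * (1 - v) ^ 3 + (1 - v) ^ 2) / (3 * freq) * flatSin (1 - v)

/-- An antiderivative of `profile`. -/
noncomputable def profilePrim (v : ℝ) : ℝ := (1 - v) ^ 4 / (3 * freq) * flatSin (1 - v)

/-- The derivative of `profile`. -/
noncomputable def profileDeriv (v : ℝ) : ℝ :=
  -((1 - v)⁻¹ ^ 2 * flatCos (1 - v) + 3 * freq * (1 - v)⁻¹ ^ 4 * flatSin (1 - v)
    - ((12 * (1 - v) ^ 2 + 2 * (1 - v)) / (3 * freq) * flatSin (1 - v)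
      + (4 * (1 - v) ^ 3 + (1 - v) ^ 2) / (3 * freq) *
        ((1 - v)⁻¹ ^ 2 * flatSin (1 - v) - 3 * freq * (1 - v)⁻¹ ^ 4 * flatCos (1 - v))))

theorem contDiff_profile : ContDiff ℝ ∞ profile := by
  have h : ContDiff ℝ ∞ fun v : ℝ ↦ 1 - v := by fun_prop
  unfold profile
  refine (contDiff_flatCos.comp h).sub (ContDiff.mul ?_ (contDiff_flatSin.comp h))
  fun_prop

theorem hasDerivAt_profile (v : ℝ) : HasDerivAt profile (profileDeriv v) v := by
  have h1 : HasDerivAt (fun v : ℝ ↦ 1 - v) (-1) v := by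
    simpa using (hasDerivAt_id v).const_sub 1
  have hp : HasDerivAt (fun v : ℝ ↦ (4 * (1 - v) ^ 3 + (1 - v) ^ 2) / (3 * freq))
      (-(12 * (1 - v) ^ 2 + 2 * (1 - v)) / (3 * freq)) v := by
    convert! (((h1.pow 3).const_mul 4).add (h1.pow 2)).div_const (3 * freq) using 1
    simp
    ring
  convert! ((hasDerivAt_flatCos (1 - v)).comp v h1).sub
    (hp.mul ((hasDerivAt_flatSin (1 - v)).comp v h1)) using 1
  simp only [profileDeriv, Function.comp]
  ring

theorem freq_pos : 0 < freq := by norm_num [freq]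

theorem flatCos_of_nonpos {z : ℝ} (hz : z ≤ 0) : flatCos z = 0 := by
  simp [flatCos, expNegInvGlue.zero_of_nonpos hz]

theorem flatSin_of_nonpos {z : ℝ} (hz : z ≤ 0) : flatSin z = 0 := by
  simp [flatSin, expNegInvGlue.zero_of_nonpos hz]

/-- The sine term in `profile` is there for this identity: it makes the primitive explicit and
smaller than the profile by a factor of order `(1 - v)⁴ / freq`. -/
theorem hasDerivAt_profilePrim (v : ℝ) : HasDerivAt profilePrim (profile v) v := by
  have h1 : HasDerivAt (fun v : ℝ ↦ 1 - v) (-1) v := by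
    simpa using (hasDerivAt_id v).const_sub 1
  have hp : HasDerivAt (fun v : ℝ ↦ (1 - v) ^ 4 / (3 * freq))
      (-(4 * (1 - v) ^ 3) / (3 * freq)) v := by
    convert! (h1.pow 4).div_const (3 * freq) using 1
    simp
  convert! hp.mul ((hasDerivAt_flatSin (1 - v)).comp v h1) using 1
  simp only [profile, Function.comp]
  rcases le_or_gt (1 - v) 0 with hz | hz
  · simp [flatCos_of_nonpos hz, flatSin_of_nonpos hz]
  · have := freq_pos
    field_simp
    ring

theorem profile_of_one_le {v : ℝ} (hv : 1 ≤ v) : profile v = 0 := by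
  have hz : 1 - v ≤ 0 := by linarith
  simp [profile, flatCos_of_nonpos hz, flatSin_of_nonpos hz]

theorem profilePrim_of_one_le {v : ℝ} (hv : 1 ≤ v) : profilePrim v = 0 := by
  have hz : 1 - v ≤ 0 := by linarith
  simp [profilePrim, flatSin_of_nonpos hz]

theorem profileDeriv_of_one_le {v : ℝ} (hv : 1 ≤ v) : profileDeriv v = 0 := by
  have hz : 1 - v ≤ 0 := by linarith
  simp [profileDeriv, flatCos_of_nonpos hz, flatSin_of_nonpos hz]

theorem abs_flatCos_le (z : ℝ) : |flatCos z| ≤ expNegInvGlue z := by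
  rw [flatCos, abs_mul, abs_of_nonneg (expNegInvGlue.nonneg z)]
  exact mul_le_of_le_one_right (expNegInvGlue.nonneg z) (Real.abs_cos_le_one _)

theorem abs_flatSin_le (z : ℝ) : |flatSin z| ≤ expNegInvGlue z := by
  rw [flatSin, abs_mul, abs_of_nonneg (expNegInvGlue.nonneg z)]
  exact mul_le_of_le_one_right (expNegInvGlue.nonneg z) (Real.abs_sin_le_one _)

theorem abs_profile_le {y v : ℝ} (hy : y ≤ 1) (hv : 1 - v ≤ y) :
    |profile v| ≤ 2 * expNegInvGlue y := by
  rcases le_or_gt 1 v with h1 | h1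
  · rw [profile_of_one_le h1, abs_zero]
    exact mul_nonneg zero_le_two (expNegInvGlue.nonneg y)
  have hm := expNegInvGlue.monotone hv
  have hz : 0 < 1 - v := by linarith
  have hz1 : 1 - v ≤ 1 := by linarith
  have hc := abs_flatCos_le (1 - v)
  have hs := abs_flatSin_le (1 - v)
  have hp0 : 0 ≤ (4 * (1 - v) ^ 3 + (1 - v) ^ 2) / (3 * freq) := by
    have := freq_pos
    positivity
  have hp1 : (4 * (1 - v) ^ 3 + (1 - v) ^ 2) / (3 * freq) ≤ 1 := by
    have h3 : (1 - v) ^ 3 ≤ 1 := pow_le_one₀ hz.le hz1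
    have h2 : (1 - v) ^ 2 ≤ 1 := pow_le_one₀ hz.le hz1
    rw [div_le_one (by norm_num [freq])]
    norm_num [freq]
    linarith
  calc |profile v| ≤ |flatCos (1 - v)|
        + |(4 * (1 - v) ^ 3 + (1 - v) ^ 2) / (3 * freq) * flatSin (1 - v)| := abs_sub _ _
    _ ≤ expNegInvGlue (1 - v) + 1 * expNegInvGlue (1 - v) := by
      rw [abs_mul, abs_of_nonneg hp0]
      gcongr
    _ ≤ 2 * expNegInvGlue y := by linarith

theorem abs_profilePrim_le {y v : ℝ} (hv : 1 - v ≤ y) :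
    |profilePrim v| ≤ y ^ 4 / (3 * freq) * expNegInvGlue y := by
  have hf := freq_pos
  rcases le_or_gt 1 v with h1 | h1
  · rw [profilePrim_of_one_le h1, abs_zero]
    exact mul_nonneg (by positivity) (expNegInvGlue.nonneg y)
  have hz : 0 < 1 - v := by linarith
  rw [profilePrim, abs_mul, abs_of_nonneg (by positivity)]
  gcongr
  exact (abs_flatSin_le _).trans (expNegInvGlue.monotone hv)

/-- The function `z⁻⁴ exp(-1/z)` is not monotone on `(0, 1]`, but it is so up to a constant; this
turns pointwise bounds into bounds uniform along a chord. -/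
theorem inv_pow_mul_expNegInvGlue_le {y z : ℝ} (hz : 0 < z) (hzy : z ≤ y) (hy : y ≤ 1) :
    z⁻¹ ^ 4 * expNegInvGlue z ≤ 256 * (y⁻¹ ^ 4 * expNegInvGlue y) := by
  have hy0 : 0 < y := hz.trans_le hzy
  have h1 : 1 ≤ y⁻¹ := (one_le_inv₀ hy0).2 hy
  have h2 : y⁻¹ ≤ z⁻¹ := (inv_le_inv₀ hy0 hz).2 hzy
  rw [expNegInvGlue, if_neg hz.not_ge, expNegInvGlue, if_neg hy0.not_ge]
  set s := y⁻¹
  set t := z⁻¹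
  -- The fourth power of this bound costs `exp(t - s)`, which converts `exp(-t)` into `exp(-s)`; `s
  -- ≥ 1` is needed.
  have h3 : t ≤ 4 * s * Real.exp ((t - s) / 4) := by
    have := Real.add_one_le_exp ((t - s) / 4)
    nlinarith
  calc t ^ 4 * Real.exp (-t) ≤ (4 * s * Real.exp ((t - s) / 4)) ^ 4 * Real.exp (-t) := by
        gcongr
    _ = 256 * (s ^ 4 * (Real.exp ((t - s) / 4) ^ 4 * Real.exp (-t))) := by ring
    _ = 256 * (s ^ 4 * Real.exp (-s)) := by
      rw [← Real.exp_nat_mul, ← Real.exp_add]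
      congr 3
      push_cast
      ring

theorem exists_abs_profileDeriv_le : ∃ K : ℝ, 0 < K ∧ ∀ y v : ℝ, y ≤ 1 → 0 < y → 1 - v ≤ y →
    |profileDeriv v| ≤ K * (y⁻¹ ^ 4 * expNegInvGlue y) := by
  have hf := freq_pos
  refine ⟨256 * (1 + 3 * freq + (14 / (3 * freq) + 5 / (3 * freq) * (1 + 3 * freq))),
    by positivity, fun y v hy hy0 hv ↦ ?_⟩
  rcases le_or_gt 1 v with h1 | h1
  · rw [profileDeriv_of_one_le h1, abs_zero]
    have := expNegInvGlue.nonneg y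
    positivity
  have hz : 0 < 1 - v := by linarith
  have hmain := inv_pow_mul_expNegInvGlue_le hz hv hy
  rw [profileDeriv, abs_neg]
  have hc := abs_flatCos_le (1 - v)
  have hs := abs_flatSin_le (1 - v)
  have hJ := expNegInvGlue.nonneg (1 - v)
  have hz1 : 1 - v ≤ 1 := by linarith
  set z := 1 - v
  have hi : 1 ≤ z⁻¹ := (one_le_inv₀ hz).2 hz1
  set s := z⁻¹
  have hs4 : 1 ≤ s ^ 4 := one_le_pow₀ hi
  have hs2 : s ^ 2 ≤ s ^ 4 := pow_le_pow_right₀ hi (by norm_num)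
  have hz2 : z ^ 2 ≤ 1 := pow_le_one₀ hz.le hz1
  have hz3 : z ^ 3 ≤ 1 := pow_le_one₀ hz.le hz1
  have e1 : |s ^ 2 * flatCos z| ≤ s ^ 4 * expNegInvGlue z := by
    rw [abs_mul, abs_of_nonneg (by positivity)]
    gcongr
  have e1' : |s ^ 2 * flatSin z| ≤ s ^ 4 * expNegInvGlue z := by
    rw [abs_mul, abs_of_nonneg (by positivity)]
    gcongr
  have e2 : |3 * freq * s ^ 4 * flatSin z| ≤ 3 * freq * (s ^ 4 * expNegInvGlue z) := by
    rw [abs_mul, abs_of_nonneg (by positivity), ← mul_assoc]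
    gcongr
  have e2' : |3 * freq * s ^ 4 * flatCos z| ≤ 3 * freq * (s ^ 4 * expNegInvGlue z) := by
    rw [abs_mul, abs_of_nonneg (by positivity), ← mul_assoc]
    gcongr
  have e3 : |(12 * z ^ 2 + 2 * z) / (3 * freq) * flatSin z|
      ≤ 14 / (3 * freq) * (s ^ 4 * expNegInvGlue z) := by
    rw [abs_mul, abs_of_nonneg (by positivity)]
    gcongr
    · linarith
    · exact hs.trans (le_mul_of_one_le_left hJ hs4)
  have e4 : |(4 * z ^ 3 + z ^ 2) / (3 * freq) *
      (s ^ 2 * flatSin z - 3 * freq * s ^ 4 * flatCos z)| ≤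
      5 / (3 * freq) * (s ^ 4 * expNegInvGlue z + 3 * freq * (s ^ 4 * expNegInvGlue z)) := by
    rw [abs_mul, abs_of_nonneg (by positivity)]
    gcongr
    · linarith
    · exact (abs_sub _ _).trans (add_le_add e1' e2')
  calc _ ≤ (s ^ 4 * expNegInvGlue z + 3 * freq * (s ^ 4 * expNegInvGlue z))
        + (14 / (3 * freq) * (s ^ 4 * expNegInvGlue z) + 5 / (3 * freq) *
          (s ^ 4 * expNegInvGlue z + 3 * freq * (s ^ 4 * expNegInvGlue z))) :=
        (abs_sub _ _).trans (add_le_add ((abs_add_le _ _).trans (add_le_add e1 e2))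
          ((abs_add_le _ _).trans (add_le_add e3 e4)))
    _ = (1 + 3 * freq + (14 / (3 * freq) + 5 / (3 * freq) * (1 + 3 * freq)))
        * (s ^ 4 * expNegInvGlue z) := by ring
    _ ≤ (1 + 3 * freq + (14 / (3 * freq) + 5 / (3 * freq) * (1 + 3 * freq)))
        * (256 * (y⁻¹ ^ 4 * expNegInvGlue y)) := by gcongr
    _ = _ := by ring

/-! ### Chord integrals: smoothness and interpolation -/

/-- The integral of `v ↦ k v` along the chord `t ↦ u + t²`. -/
noncomputable def chordIntegral (k : ℝ → ℝ) (u : ℝ) : ℝ := ∫ t in (-2 : ℝ)..2, k (u + t ^ 2)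

theorem hasDerivAt_chordIntegral {k k' : ℝ → ℝ} (hk : ∀ v, HasDerivAt k (k' v) v)
    (hk' : Continuous k') (u : ℝ) :
    HasDerivAt (chordIntegral k) (chordIntegral k' u) u := by
  have hkc : Continuous k := continuous_iff_continuousAt.2 fun v ↦ (hk v).continuousAt
  obtain ⟨M, hM⟩ := (isCompact_Icc (a := u - 1) (b := u + 5)).exists_bound_of_continuousOn
    hk'.continuousOn
  refine (intervalIntegral.hasDerivAt_integral_of_dominated_loc_of_deriv_le
    (F := fun x t ↦ k (x + t ^ 2)) (F' := fun x t ↦ k' (x + t ^ 2)) (bound := fun _ ↦ M)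
    (ball_mem_nhds u one_pos) ?_ ?_ ?_ ?_ ?_ ?_).2
  · exact Filter.Eventually.of_forall fun x ↦
      (hkc.comp (by fun_prop : Continuous fun t : ℝ ↦ x + t ^ 2)).aestronglyMeasurable
  · exact (hkc.comp (by fun_prop : Continuous fun t : ℝ ↦ u + t ^ 2)).intervalIntegrable _ _
  · exact (hk'.comp (by fun_prop : Continuous fun t : ℝ ↦ u + t ^ 2)).aestronglyMeasurable
  · refine Filter.Eventually.of_forall fun t ht x hx ↦ hM _ ?_
    rw [Set.uIoc_of_le (by norm_num)] at ht
    rw [Real.ball_eq_Ioo] at hx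
    constructor <;> nlinarith [ht.1, ht.2, hx.1, hx.2]
  · exact intervalIntegrable_const
  · exact Filter.Eventually.of_forall fun t _ x _ ↦ (hk _).comp_add_const x (t ^ 2)

theorem contDiff_chordIntegral {k : ℝ → ℝ} (hk : ContDiff ℝ ∞ k) :
    ContDiff ℝ ∞ (chordIntegral k) := by
  refine contDiff_infty.2 fun m ↦ ?_
  have key {k : ℝ → ℝ} (hk : ContDiff ℝ ∞ k) (u : ℝ) :
      HasDerivAt (chordIntegral k) (chordIntegral (deriv k) u) u :=
    hasDerivAt_chordIntegral (fun v ↦ (hk.differentiable (by simp) v).hasDerivAt)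
      (contDiff_infty_iff_deriv.1 hk).2.continuous u
  induction m generalizing k with
  | zero =>
    exact contDiff_zero.2 (continuous_iff_continuousAt.2 fun u ↦ (key hk u).continuousAt)
  | succ m ihm =>
    rw [show ((m + 1 : ℕ) : WithTop ℕ∞) = m + 1 from rfl]
    refine contDiff_succ_iff_deriv.2 ⟨fun u ↦ (key hk u).differentiableAt, by simp, ?_⟩
    rw [show deriv (chordIntegral k) = _ from funext fun u ↦ (key hk u).deriv]
    exact ihm (contDiff_infty_iff_deriv.1 hk).2

theorem abs_chordIntegral_le {k : ℝ → ℝ} {u M : ℝ} (hM : ∀ v, u ≤ v → |k v| ≤ M) :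
    |chordIntegral k u| ≤ 4 * M := by
  have := intervalIntegral.norm_integral_le_of_norm_le_const (a := (-2 : ℝ)) (b := 2) (C := M)
    (f := fun t ↦ k (u + t ^ 2)) fun t _ ↦ hM _ (by nlinarith [sq_nonneg t])
  rw [chordIntegral, mul_comm]
  convert! this using 2
  norm_num

theorem chordIntegral_eq_two_mul {k : ℝ → ℝ} (hk : Continuous k) (u : ℝ) :
    chordIntegral k u = 2 * ∫ t in (0 : ℝ)..2, k (u + t ^ 2) := by
  have hc : Continuous fun t : ℝ ↦ k (u + t ^ 2) := by fun_prop
  have h := intervalIntegral.integral_comp_neg (a := 0) (b := 2) fun t : ℝ ↦ k (u + t ^ 2)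
  simp only [neg_sq, neg_zero] at h
  rw [chordIntegral, ← intervalIntegral.integral_add_adjacent_intervals
    (hc.intervalIntegrable (-2) 0) (hc.intervalIntegrable 0 2), ← h]
  ring

/-- Interpolation bound: a chord integral is small if the integrand has a small primitive. -/
theorem abs_chordIntegral_le_of_prim {k g : ℝ → ℝ} {u A B δ : ℝ} (hk : Continuous k)
    (hg : ∀ v, HasDerivAt g (k v) v) (hA : ∀ v, u ≤ v → |k v| ≤ A)
    (hB : ∀ v, u ≤ v → |g v| ≤ B) (hend : g (u + 4) = 0) (hδ : 0 < δ) (hδ2 : δ ≤ 2) :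
    |chordIntegral k u| ≤ 2 * (A * δ + B / δ) := by
  have hc : Continuous fun t : ℝ ↦ k (u + t ^ 2) := by fun_prop
  have hgc : Continuous g := continuous_iff_continuousAt.2 fun v ↦ (hg v).continuousAt
  have hB0 : 0 ≤ B := (abs_nonneg _).trans (hB u le_rfl)
  have hpos : ∀ t ∈ Set.uIcc δ 2, t ≠ 0 := fun t ht ↦ by
    rw [Set.uIcc_of_le hδ2] at ht
    exact (hδ.trans_le ht.1).ne'
  have hI2 : IntervalIntegrable (fun t : ℝ ↦ g (u + t ^ 2) / (2 * t ^ 2)) volume δ 2 := by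
    refine ContinuousOn.intervalIntegrable fun t ht ↦ ContinuousAt.continuousWithinAt ?_
    have := hpos t ht
    exact ContinuousAt.div (by fun_prop) (by fun_prop) (by positivity)
  have hI3 : IntervalIntegrable (fun t : ℝ ↦ B / (2 * t ^ 2)) volume δ 2 := by
    refine ContinuousOn.intervalIntegrable fun t ht ↦ ContinuousAt.continuousWithinAt ?_
    have := hpos t ht
    exact ContinuousAt.div (by fun_prop) (by fun_prop) (by positivity)
  have h1 : |∫ t in (0 : ℝ)..δ, k (u + t ^ 2)| ≤ A * δ := by
    have := intervalIntegral.norm_integral_le_of_norm_le_const (a := 0) (b := δ) (C := A)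
      (f := fun t ↦ k (u + t ^ 2)) fun t _ ↦ hA _ (by nlinarith [sq_nonneg t])
    rwa [sub_zero, abs_of_pos hδ] at this
  -- Integration by parts away from the midpoint of the chord, where `k(u + t²)` is the derivative
  -- of `g(u + t²)` divided by `2t`. The stationary piece `[0, δ]` is estimated trivially.
  have h2 : ∫ t in δ..2, (k (u + t ^ 2) - g (u + t ^ 2) / (2 * t ^ 2))
      = g (u + 2 ^ 2) / (2 * 2) - g (u + δ ^ 2) / (2 * δ) := by
    refine intervalIntegral.integral_eq_sub_of_hasDerivAt
      (f := fun t ↦ g (u + t ^ 2) / (2 * t)) (fun t ht ↦ ?_)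
      ((hc.intervalIntegrable _ _).sub hI2)
    have ht0 := hpos t ht
    have hs : HasDerivAt (fun t : ℝ ↦ u + t ^ 2) (2 * t) t := by
      simpa using (hasDerivAt_pow 2 t).const_add u
    have hd : HasDerivAt (fun t : ℝ ↦ 2 * t) 2 t := by
      simpa using (hasDerivAt_id t).const_mul (2 : ℝ)
    convert! ((hg (u + t ^ 2)).comp t hs).div hd (mul_ne_zero two_ne_zero ht0) using 1
    simp only [Function.comp]
    field_simp
  have h3 : |∫ t in δ..2, g (u + t ^ 2) / (2 * t ^ 2)| ≤ B / (2 * δ) := by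
    calc |∫ t in δ..2, g (u + t ^ 2) / (2 * t ^ 2)|
        ≤ ∫ t in δ..2, B / (2 * t ^ 2) := by
          rw [← Real.norm_eq_abs]
          refine intervalIntegral.norm_integral_le_of_norm_le hδ2
            (Filter.Eventually.of_forall fun t ht ↦ ?_) hI3
          rw [Real.norm_eq_abs, abs_div, abs_of_nonneg (by positivity : 0 ≤ 2 * t ^ 2)]
          gcongr
          exact hB _ (by nlinarith [sq_nonneg t])
      _ = -(B / 2) * 2⁻¹ - -(B / 2) * δ⁻¹ := by
          refine intervalIntegral.integral_eq_sub_of_hasDerivAt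
            (f := fun t ↦ -(B / 2) * t⁻¹) (fun t ht ↦ ?_) hI3
          convert! (hasDerivAt_inv (hpos t ht)).const_mul (-(B / 2)) using 1
          have := hpos t ht
          field_simp
      _ ≤ B / (2 * δ) := by
          have : B / (2 * δ) = B / 2 * δ⁻¹ := by field_simp
          rw [this]
          linarith
  rw [intervalIntegral.integral_sub (hc.intervalIntegrable _ _) hI2,
    show u + (2 : ℝ) ^ 2 = u + 4 by ring, hend] at h2
  have h4 : |g (u + δ ^ 2) / (2 * δ)| ≤ B / (2 * δ) := by
    rw [abs_div, abs_of_pos (by positivity : 0 < 2 * δ)]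
    gcongr
    exact hB _ (by nlinarith [sq_nonneg δ])
  have h5 : B / δ = B / (2 * δ) + B / (2 * δ) := by
    field_simp
    ring
  rw [chordIntegral_eq_two_mul hk, abs_mul, abs_two, h5,
    ← intervalIntegral.integral_add_adjacent_intervals
      (hc.intervalIntegrable 0 δ) (hc.intervalIntegrable δ 2)]
  rw [abs_le] at h1 h3 h4
  refine mul_le_mul_of_nonneg_left (abs_le.2 ?_) zero_le_two
  constructor <;> linarith [h1.1, h1.2, h3.1, h3.2, h4.1, h4.2]

/-! ### Smallness of the chord integral of the profile -/

theorem continuous_profile : Continuous profile := contDiff_profile.continuous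

theorem continuous_profileDeriv : Continuous profileDeriv := by
  have h : deriv profile = profileDeriv := funext fun v ↦ (hasDerivAt_profile v).deriv
  exact h ▸ (contDiff_infty_iff_deriv.1 contDiff_profile).2.continuous

theorem abs_chordIntegral_profile_le {u : ℝ} (hu : 0 ≤ u) (hu1 : u < 1) :
    |chordIntegral profile u| ≤ (1 - u) ^ 2 * expNegInvGlue (1 - u) / 128 := by
  have hy : 0 < 1 - u := by linarith
  have hJ := expNegInvGlue.nonneg (1 - u)
  -- The two terms `A δ` and `B / δ` are both of order `(1 - u)² J` when `δ` is proportional to `(1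
  -- - u)² / √freq`, and `√freq = 640`.
  have h := abs_chordIntegral_le_of_prim (u := u) (A := 2 * expNegInvGlue (1 - u))
    (B := (1 - u) ^ 4 / (3 * freq) * expNegInvGlue (1 - u)) (δ := (1 - u) ^ 2 / 640)
    continuous_profile hasDerivAt_profilePrim (fun v hv ↦ abs_profile_le (by linarith) (by linarith))
    (fun v hv ↦ abs_profilePrim_le (by linarith)) (profilePrim_of_one_le (by linarith))
    (by positivity) (by nlinarith)
  refine h.trans ?_
  have e : (1 - u) ^ 4 / (3 * freq) * expNegInvGlue (1 - u) / ((1 - u) ^ 2 / 640)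
      = (1 - u) ^ 2 * expNegInvGlue (1 - u) / 1920 := by
    rw [freq]
    field_simp
    ring
  rw [e]
  nlinarith [mul_nonneg (sq_nonneg (1 - u)) hJ]

/-! ### Lower bound for the chord integral of the squared profile -/

/-- A function of `z = 1 - v` whose derivative minorizes `(profile v / expNegInvGlue z)²`. -/
noncomputable def sqPrim (z : ℝ) : ℝ :=
  z / 2 - z ^ 4 * Real.sin (2 * (freq * z⁻¹ ^ 3)) / (12 * freq) - 2 * z / freq

/-- The derivative of `sqPrim`. -/
noncomputable def sqPrimDeriv (z : ℝ) : ℝ :=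
  Real.cos (freq * z⁻¹ ^ 3) ^ 2 - z ^ 3 * Real.sin (2 * (freq * z⁻¹ ^ 3)) / (3 * freq) - 2 / freq

theorem hasDerivAt_sqPrim {z : ℝ} (hz : z ≠ 0) : HasDerivAt sqPrim (sqPrimDeriv z) z := by
  have hf := freq_pos
  have h2 : HasDerivAt (fun x : ℝ ↦ 2 * (freq * x⁻¹ ^ 3)) (-6 * freq * z⁻¹ ^ 4) z := by
    convert! (((hasDerivAt_inv hz).pow 3).const_mul freq).const_mul 2 using 1
    push_cast
    ring
  convert! (((hasDerivAt_id z).div_const 2).sub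
    (((hasDerivAt_pow 4 z).mul h2.sin).div_const (12 * freq))).sub
    (((hasDerivAt_id z).const_mul 2).div_const freq) using 1
  rw [sqPrimDeriv, Real.cos_sq]
  field_simp
  ring

/-- The term `-2 / freq` in `sqPrimDeriv` absorbs two errors: `5 / (3 freq)` from the cross term of
the square and `1 / (3 freq)` from the `z³ sin` term. -/
theorem sqPrimDeriv_le {z : ℝ} (hz : 0 < z) (hz1 : z ≤ 1) :
    expNegInvGlue z ^ 2 * sqPrimDeriv z ≤ profile (1 - z) ^ 2 := by
  have hf := freq_pos
  have hz2 : z ^ 2 ≤ 1 := pow_le_one₀ hz.le hz1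
  have hz3 : z ^ 3 ≤ 1 := pow_le_one₀ hz.le hz1
  have hz3' : 0 ≤ z ^ 3 := by positivity
  rw [profile, sub_sub_cancel, flatCos, flatSin, sqPrimDeriv]
  set a := freq * z⁻¹ ^ 3
  have hε0 : 0 ≤ (4 * z ^ 3 + z ^ 2) / (3 * freq) := by positivity
  have hε1 : (4 * z ^ 3 + z ^ 2) / (3 * freq) ≤ 5 / (3 * freq) := by
    gcongr
    linarith
  set ε := (4 * z ^ 3 + z ^ 2) / (3 * freq)
  have hs1 := Real.sin_le_one (2 * a)
  have hs2 := Real.neg_one_le_sin (2 * a)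
  have e1 : -(1 / (3 * freq)) ≤ z ^ 3 * Real.sin (2 * a) / (3 * freq) := by
    rw [neg_div' , div_le_div_iff_of_pos_right (by positivity)]
    nlinarith
  have e2 : ε * Real.sin (2 * a) ≤ 5 / (3 * freq) := by nlinarith
  have e3 : 1 / (3 * freq) + 5 / (3 * freq) = 2 / freq := by
    field_simp
    norm_num
  have : (expNegInvGlue z * Real.cos a - ε * (expNegInvGlue z * Real.sin a)) ^ 2
      = expNegInvGlue z ^ 2 * (Real.cos a ^ 2 - ε * Real.sin (2 * a) + (ε * Real.sin a) ^ 2) := by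
    rw [Real.sin_two_mul]
    ring
  rw [this]
  gcongr
  nlinarith [sq_nonneg (ε * Real.sin a)]

/-- The hypotheses give `1/z - 1/y ≤ 1/3`, and `2/3 < log 2`. -/
theorem expNegInvGlue_sq_le {y z : ℝ} (hy : 0 < y) (hz : 3 * y / 4 ≤ z)
    (hz' : y - y ^ 2 / 4 ≤ z) : expNegInvGlue y ^ 2 / 2 ≤ expNegInvGlue z ^ 2 := by
  have hz0 : 0 < z := by linarith
  simp only [expNegInvGlue, hz0.not_ge, hy.not_ge, if_false]
  rw [← Real.exp_nat_mul, ← Real.exp_nat_mul, div_le_iff₀ two_pos, ← Real.exp_log two_pos, ← Real.exp_add,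
    Real.exp_le_exp]
  have h1 : z⁻¹ - y⁻¹ ≤ 1 / 3 := by
    rw [inv_sub_inv hz0.ne' hy.ne', div_le_iff₀ (by positivity)]
    nlinarith
  have := Real.log_two_gt_d9
  push_cast
  linarith

/-- Only the part `0 ≤ t ≤ y / 2` of the chord is used: there `exp(-2/z)` is comparable to its value
at `z = y`, while `cos²` still averages to about 1/2. -/
theorem chordIntegral_profile_sq_ge {u : ℝ} (hu : 0 ≤ u) (hu1 : u < 1) :
    (1 - u) * expNegInvGlue (1 - u) ^ 2 / 32 ≤ chordIntegral (fun v ↦ profile v ^ 2) u := by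
  obtain ⟨y, rfl⟩ : ∃ y, u = 1 - y := ⟨1 - u, by ring⟩
  rw [sub_sub_cancel]
  have hy : 0 < y := by linarith
  have hy1 : y ≤ 1 := by linarith
  have hf := freq_pos
  have hc : Continuous fun t : ℝ ↦ profile (1 - y + t ^ 2) ^ 2 := by
    have := continuous_profile
    fun_prop
  have hz : ∀ t ∈ Set.Icc 0 (y / 2), 3 * y / 4 ≤ y - t ^ 2 ∧ y - y ^ 2 / 4 ≤ y - t ^ 2 := by
    intro t ht
    constructor <;> nlinarith [ht.1, ht.2]
  have hcd : ContinuousOn (fun t : ℝ ↦ sqPrimDeriv (y - t ^ 2) * (2 * t)) (Set.uIcc 0 (y / 2)) := by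
    intro t ht
    rw [Set.uIcc_of_le (by positivity)] at ht
    have h0 : y - t ^ 2 ≠ 0 := by linarith [(hz t ht).1]
    refine ContinuousAt.continuousWithinAt ?_
    unfold sqPrimDeriv
    have hi : ContinuousAt (fun t : ℝ ↦ (y - t ^ 2)⁻¹) t :=
      ContinuousAt.inv₀ (by fun_prop) h0
    have hθ : ContinuousAt (fun t : ℝ ↦ freq * (y - t ^ 2)⁻¹ ^ 3) t := by fun_prop
    fun_prop
  have hFTC : ∫ t in (0 : ℝ)..(y / 2), sqPrimDeriv (y - t ^ 2) * (2 * t)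
      = -sqPrim (y - (y / 2) ^ 2) - -sqPrim (y - 0 ^ 2) := by
    refine intervalIntegral.integral_eq_sub_of_hasDerivAt
      (f := fun t ↦ -sqPrim (y - t ^ 2)) (fun t ht ↦ ?_) hcd.intervalIntegrable
    rw [Set.uIcc_of_le (by positivity)] at ht
    have h0 : y - t ^ 2 ≠ 0 := by linarith [(hz t ht).1]
    have hs : HasDerivAt (fun t : ℝ ↦ y - t ^ 2) (-(2 * t)) t := by
      simpa using (hasDerivAt_pow 2 t).const_sub y
    convert! ((hasDerivAt_sqPrim h0).comp t hs).neg using 1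
    simp
  -- The linear part `z / 2` of `sqPrim` contributes `y² / 8`; the rest is small because `freq` is
  -- large.
  have hlow : y ^ 2 / 16 ≤ -sqPrim (y - (y / 2) ^ 2) - -sqPrim (y - 0 ^ 2) := by
    have hb : ∀ z : ℝ, 0 ≤ z → z ≤ y → ∀ a : ℝ,
        |z ^ 4 * Real.sin a / (12 * freq)| ≤ y ^ 2 / (12 * freq) := by
      intro z h0 hzy a
      rw [abs_div, abs_of_pos (by positivity : 0 < 12 * freq), abs_mul,
        abs_of_nonneg (by positivity)]
      gcongr
      have : z ^ 4 ≤ y ^ 4 := by gcongr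
      have : y ^ 4 ≤ y ^ 2 := pow_le_pow_of_le_one hy.le hy1 (by norm_num)
      nlinarith [Real.abs_sin_le_one a, abs_nonneg (Real.sin a), pow_nonneg h0 4]
    have b1 := abs_le.1 (hb (y - (y / 2) ^ 2) (by nlinarith) (by nlinarith)
      (2 * (freq * (y - (y / 2) ^ 2)⁻¹ ^ 3)))
    have b2 := abs_le.1 (hb (y - 0 ^ 2) (by nlinarith) (by nlinarith)
      (2 * (freq * (y - 0 ^ 2)⁻¹ ^ 3)))
    unfold sqPrim
    have e1 : y ^ 2 / (12 * freq) = y ^ 2 * (1 / 12 / freq) := by field_simp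
    have e2 : 2 * (y - (y / 2) ^ 2) / freq = 2 * y / freq - y ^ 2 * (1 / 2 / freq) := by
      field_simp
    have e3 : 2 * (y - 0 ^ 2) / freq = 2 * y / freq := by ring
    have e4 : 1 / 12 / freq ≤ 1 / 1000 := by norm_num [freq]
    have e5 : 1 / 2 / freq ≤ 1 / 1000 := by norm_num [freq]
    rw [e2, e3]
    rw [e1] at b1 b2
    nlinarith [b1.1, b1.2, b2.1, b2.2, sq_nonneg y]
  -- Inserting the factor `2t / y ≤ 1` supplies the Jacobian of `z = y - t²`, so the minorant
  -- integrates exactly.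
  have hcmp : ∫ t in (0 : ℝ)..(y / 2), expNegInvGlue y ^ 2 / (2 * y) *
      (sqPrimDeriv (y - t ^ 2) * (2 * t)) ≤ ∫ t in (0 : ℝ)..(y / 2), profile (1 - y + t ^ 2) ^ 2 := by
    refine intervalIntegral.integral_mono_on (by positivity)
      (hcd.intervalIntegrable.const_mul _) (hc.intervalIntegrable _ _) fun t ht ↦ ?_
    obtain ⟨hz1, hz2⟩ := hz t ht
    have hz0 : 0 < y - t ^ 2 := by linarith
    have hzy : y - t ^ 2 ≤ y := by nlinarith
    have h1 := sqPrimDeriv_le hz0 (hzy.trans hy1)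
    have h2 := expNegInvGlue_sq_le hy hz1 hz2
    rw [show 1 - (y - t ^ 2) = 1 - y + t ^ 2 by ring] at h1
    have h3 : expNegInvGlue y ^ 2 / 2 * sqPrimDeriv (y - t ^ 2) ≤ profile (1 - y + t ^ 2) ^ 2 := by
      rcases le_or_gt 0 (sqPrimDeriv (y - t ^ 2)) with h | h
      · exact (mul_le_mul_of_nonneg_right h2 h).trans h1
      · exact (mul_nonpos_of_nonneg_of_nonpos (by positivity) h.le).trans (sq_nonneg _)
    have ht1 : 0 ≤ 2 * t / y := div_nonneg (by linarith [ht.1]) hy.le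
    have ht2 : 2 * t / y ≤ 1 := (div_le_one hy).2 (by linarith [ht.2])
    calc _ = 2 * t / y * (expNegInvGlue y ^ 2 / 2 * sqPrimDeriv (y - t ^ 2)) := by
          field_simp
      _ ≤ 2 * t / y * profile (1 - y + t ^ 2) ^ 2 := by gcongr
      _ ≤ profile (1 - y + t ^ 2) ^ 2 := mul_le_of_le_one_left (sq_nonneg _) ht2
  rw [intervalIntegral.integral_const_mul, hFTC] at hcmp
  calc y * expNegInvGlue y ^ 2 / 32 = expNegInvGlue y ^ 2 / (2 * y) * (y ^ 2 / 16) := by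
        field_simp
        ring
    _ ≤ _ := mul_le_mul_of_nonneg_left hlow (by positivity)
    _ ≤ _ := hcmp
    _ ≤ _ := intervalIntegral.integral_mono_interval (by norm_num) (by positivity)
        (by linarith) (Filter.Eventually.of_forall fun t ↦ sq_nonneg _)
        (hc.intervalIntegrable _ _)

/-! ### The ratio `F / H`, the correction and their regularity -/

/-- The quotient of the ray transform of the profile by that of its square, as a function of the
squared distance of the line from the origin. -/
noncomputable def chordRatio (u : ℝ) : ℝ :=
  chordIntegral profile u / chordIntegral (fun v ↦ profile v ^ 2) u

/-- The deviation of the weight from `1`, in the variables `u = r²` and `v = |x|²`. -/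
noncomputable def correction (u v : ℝ) : ℝ := profile v * chordRatio u

theorem chordIntegral_profile_of_one_le {u : ℝ} (hu : 1 ≤ u) : chordIntegral profile u = 0 := by
  simp [chordIntegral, fun t : ℝ ↦ profile_of_one_le (v := u + t ^ 2) (by nlinarith [sq_nonneg t])]

theorem chordRatio_of_one_le {u : ℝ} (hu : 1 ≤ u) : chordRatio u = 0 := by
  rw [chordRatio, chordIntegral_profile_of_one_le hu, zero_div]

theorem chordIntegral_profile_sq_pos {u : ℝ} (hu : 0 ≤ u) (hu1 : u < 1) :
    0 < chordIntegral (fun v ↦ profile v ^ 2) u := by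
  have hJ := expNegInvGlue.pos_of_pos (sub_pos.2 hu1)
  have hy := sub_pos.2 hu1
  exact lt_of_lt_of_le (by positivity) (chordIntegral_profile_sq_ge hu hu1)

theorem contDiffAt_chordRatio {u : ℝ} (hu : 0 ≤ u) (hu1 : u ≠ 1) :
    ContDiffAt ℝ ∞ chordRatio u := by
  rcases lt_or_gt_of_ne hu1 with h | h
  · exact (contDiff_chordIntegral contDiff_profile).contDiffAt.div
      (contDiff_chordIntegral (contDiff_profile.pow 2)).contDiffAt
      (chordIntegral_profile_sq_pos hu h).ne'
  · refine (contDiffAt_const (c := (0 : ℝ))).congr_of_eventuallyEq ?_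
    filter_upwards [lt_mem_nhds h] with w hw
    exact chordRatio_of_one_le hw.le

theorem abs_chordRatio_le {u : ℝ} (hu : 0 ≤ u) (hu1 : u < 1) :
    |chordRatio u| ≤ (1 - u) / (4 * expNegInvGlue (1 - u)) := by
  have hJ := expNegInvGlue.pos_of_pos (sub_pos.2 hu1)
  have hy := sub_pos.2 hu1
  have h1 := abs_chordIntegral_profile_le hu hu1
  have h2 := chordIntegral_profile_sq_ge hu hu1
  have h3 := chordIntegral_profile_sq_pos hu hu1
  rw [chordRatio, abs_div, abs_of_pos h3]
  calc _ ≤ ((1 - u) ^ 2 * expNegInvGlue (1 - u) / 128)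
        / ((1 - u) * expNegInvGlue (1 - u) ^ 2 / 32) := by gcongr
    _ = _ := by
      field_simp
      ring

/-- In `(F' - (F / H) H') / H` the term `F'` dominates: its size `y⁻⁴ J` divided by the lower bound
`y J²` for `H` gives the rate. -/
theorem exists_abs_deriv_chordRatio_le : ∃ K : ℝ, 0 < K ∧ ∀ u : ℝ, 0 ≤ u → u < 1 →
    ∃ q, HasDerivAt chordRatio q u ∧ |q| ≤ K * ((1 - u)⁻¹ ^ 5 / expNegInvGlue (1 - u)) := by
  obtain ⟨K, hK, hKb⟩ := exists_abs_profileDeriv_le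
  refine ⟨256 * K, by positivity, fun u hu hu1 ↦ ?_⟩
  have hQ := abs_chordRatio_le hu hu1
  have hH := chordIntegral_profile_sq_ge hu hu1
  have hH0 := chordIntegral_profile_sq_pos hu hu1
  have hy := sub_pos.2 hu1
  have hJ := expNegInvGlue.pos_of_pos hy
  have hy1 : 1 - u ≤ 1 := by linarith
  have hF' := hasDerivAt_chordIntegral hasDerivAt_profile continuous_profileDeriv u
  have hH' := hasDerivAt_chordIntegral (k := fun v ↦ profile v ^ 2)
    (k' := fun v ↦ 2 * profile v * profileDeriv v)
    (fun v ↦ by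
      convert! (hasDerivAt_profile v).pow 2 using 1
      simp)
    ((continuous_const.mul continuous_profile).mul continuous_profileDeriv) u
  refine ⟨_, hF'.div hH' hH0.ne', ?_⟩
  have bF := abs_chordIntegral_le (k := profileDeriv) (u := u) fun v hv ↦
    hKb (1 - u) v hy1 hy (by linarith)
  have bH := abs_chordIntegral_le (k := fun v ↦ 2 * profile v * profileDeriv v) (u := u)
    (M := 2 * (2 * expNegInvGlue (1 - u)) * (K * ((1 - u)⁻¹ ^ 4 * expNegInvGlue (1 - u))))
    fun v hv ↦ by
      rw [abs_mul, abs_mul, abs_two]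
      gcongr
      · exact abs_profile_le hy1 (by linarith)
      · exact hKb (1 - u) v hy1 hy (by linarith)
  rw [chordRatio] at hQ
  set F := chordIntegral profile u
  set H := chordIntegral (fun v ↦ profile v ^ 2) u
  set F' := chordIntegral profileDeriv u
  set H' := chordIntegral (fun v ↦ 2 * profile v * profileDeriv v) u
  set y := 1 - u
  set J := expNegInvGlue y
  have hinv : 1 ≤ y⁻¹ := (one_le_inv₀ hy).2 hy1
  have e : (F' * H - F * H') / H ^ 2 = (F' - F / H * H') / H := by
    field_simp
  rw [e, abs_div, abs_of_pos hH0]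
  calc |F' - F / H * H'| / H
      ≤ (4 * (K * (y⁻¹ ^ 4 * J)) + y / (4 * J) * (4 * (2 * (2 * J) * (K * (y⁻¹ ^ 4 * J)))))
        / (y * J ^ 2 / 32) := by
        gcongr
        refine (abs_sub _ _).trans (add_le_add bF ?_)
        rw [abs_mul]
        gcongr
    _ = 128 * K * (y⁻¹ ^ 5 / J) * (1 + y) := by
        field_simp
        ring
    _ ≤ 128 * K * (y⁻¹ ^ 5 / J) * 2 := by
        gcongr
        linarith
    _ = 256 * K * (y⁻¹ ^ 5 / J) := by ring

/-- Since `u ≤ v`, the factor `expNegInvGlue (1 - u)` bounding the profile cancels the one in the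
denominator of the ratio bound. -/
theorem abs_correction_le {u v : ℝ} (hu : 0 ≤ u) (huv : u ≤ v) :
    |correction u v| ≤ max (1 - u) 0 / 2 := by
  rcases le_or_gt 1 u with h | h
  · rw [correction, chordRatio_of_one_le h, mul_zero, abs_zero]
    positivity
  have hy := sub_pos.2 h
  have hJ := expNegInvGlue.pos_of_pos hy
  have h1 := abs_profile_le (y := 1 - u) (v := v) (by linarith) (by linarith)
  have h2 := abs_chordRatio_le hu h
  rw [correction, abs_mul, max_eq_left hy.le]
  calc _ ≤ 2 * expNegInvGlue (1 - u) * ((1 - u) / (4 * expNegInvGlue (1 - u))) := by gcongr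
    _ = (1 - u) / 2 := by
      field_simp
      ring

/-- Close to `u = 1` both values are `O(η)`; elsewhere the mean value theorem applies and `η⁸` beats
the losses `y⁻⁴` and `y⁻⁵`. The order `u ≤ u'` matters: the profile difference is paired with the
ratio at `u`, the ratio difference with the profile at `v' ≥ u'`, and in each product the
exponentials cancel exactly. -/
theorem exists_abs_correction_sub_le_of_le : ∃ C : ℝ, ∀ η u u' v v' : ℝ, 0 ≤ η → η ≤ 1 → 0 ≤ u →
    u ≤ u' → u ≤ v → u' ≤ v' → |u - u'| ≤ 20 * η ^ 8 → |v - v'| ≤ 20 * η ^ 8 →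
    |correction u v - correction u' v'| ≤ C * η := by
  obtain ⟨K, hK, hKb⟩ := exists_abs_profileDeriv_le
  obtain ⟨L, hL, hLb⟩ := exists_abs_deriv_chordRatio_le
  refine ⟨40 + (5 * K + 40 * L), fun η u u' v v' hη hη1 hu huu huv huv' hdu hdv ↦ ?_⟩
  -- With threshold 40, twice the 20 of the hypotheses, the second case keeps `1 - u` and `1 - u'`
  -- comparable within a factor 2.
  rcases le_or_gt (1 - u) (40 * η) with hc | hc
  · have h1 := abs_correction_le hu huv
    have h2 := abs_correction_le (hu.trans huu) huv'
    have h3 : max (1 - u) 0 ≤ 40 * η := max_le hc (by positivity)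
    have h4 : max (1 - u') 0 ≤ 40 * η := max_le (by linarith) (by positivity)
    have h5 : 0 ≤ (5 * K + 40 * L) * η := by positivity
    calc _ ≤ |correction u v| + |correction u' v'| := abs_sub _ _
      _ ≤ _ := by linarith
  have hη8 : η ^ 8 ≤ η := pow_le_of_le_one hη hη1 (by norm_num)
  have hy : 0 < 1 - u := by linarith
  have hyy' : 1 - u ≤ 2 * (1 - u') := by linarith [(abs_le.1 hdu).1]
  have hηy' : η ≤ 1 - u' := by linarith
  have hy' : 0 < 1 - u' := by linarith
  have hJ := expNegInvGlue.pos_of_pos hy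
  have hJ' := expNegInvGlue.pos_of_pos hy'
  have hQ := abs_chordRatio_le hu (by linarith)
  have hp := abs_profile_le (y := 1 - u') (v := v') (by linarith) (by linarith)
  have hdp : |profile v - profile v'| ≤
      K * ((1 - u)⁻¹ ^ 4 * expNegInvGlue (1 - u)) * |v - v'| :=
    (convex_Ici u).norm_image_sub_le_of_norm_hasDerivWithin_le
      (fun w _ ↦ (hasDerivAt_profile w).hasDerivWithinAt)
      (fun w hw ↦ hKb (1 - u) w (by linarith) hy (by linarith [Set.mem_Ici.1 hw]))
      (huu.trans huv') huv
  have hdQ : |chordRatio u - chordRatio u'| ≤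
      L * ((1 - u')⁻¹ ^ 5 / expNegInvGlue (1 - u')) * |u - u'| := by
    refine (convex_Icc u u').norm_image_sub_le_of_norm_hasDerivWithin_le (f' := deriv chordRatio)
      (fun w hw ↦ ?_) (fun w hw ↦ ?_) ⟨huu, le_rfl⟩ ⟨le_rfl, huu⟩
    · obtain ⟨q, hq, -⟩ := hLb w (hu.trans hw.1) (by linarith [hw.2])
      exact hq.differentiableAt.hasDerivAt.hasDerivWithinAt
    · obtain ⟨q, hq, hqb⟩ := hLb w (hu.trans hw.1) (by linarith [hw.2])
      rw [hq.deriv]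
      refine hqb.trans ?_
      have hw' : 1 - u' ≤ 1 - w := by linarith [hw.2]
      have hm := expNegInvGlue.monotone hw'
      have hw0 : 0 < 1 - w := hy'.trans_le hw'
      gcongr
  have hη4 : (1 - u)⁻¹ ^ 4 * η ^ 8 ≤ η := by
    have h1 : η ≤ 1 - u := by linarith
    have h2 : η ^ 4 ≤ (1 - u) ^ 4 := by gcongr
    calc (1 - u)⁻¹ ^ 4 * η ^ 8 = η ^ 4 / (1 - u) ^ 4 * η ^ 4 := by
          field_simp
      _ ≤ 1 * η := by
          gcongr
          · exact (div_le_one (by positivity)).2 h2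
          · exact pow_le_of_le_one hη hη1 (by norm_num)
      _ = η := one_mul _
  have hη5 : (1 - u')⁻¹ ^ 5 * η ^ 8 ≤ η := by
    have h2 : η ^ 5 ≤ (1 - u') ^ 5 := by gcongr
    calc (1 - u')⁻¹ ^ 5 * η ^ 8 = η ^ 5 / (1 - u') ^ 5 * η ^ 3 := by
          field_simp
      _ ≤ 1 * η := by
          gcongr
          · exact (div_le_one (by positivity)).2 h2
          · exact pow_le_of_le_one hη hη1 (by norm_num)
      _ = η := one_mul _
  have t1 : |profile v - profile v'| * |chordRatio u| ≤ 5 * K * η := by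
    calc _ ≤ K * ((1 - u)⁻¹ ^ 4 * expNegInvGlue (1 - u)) * (20 * η ^ 8)
          * ((1 - u) / (4 * expNegInvGlue (1 - u))) := by gcongr; exact hdp.trans (by gcongr)
      _ = 5 * K * ((1 - u)⁻¹ ^ 4 * η ^ 8) * (1 - u) := by
          field_simp
          ring
      _ ≤ 5 * K * η * 1 := by
          gcongr
          linarith
      _ = 5 * K * η := mul_one _
  have t2 : |profile v'| * |chordRatio u - chordRatio u'| ≤ 40 * L * η := by
    calc _ ≤ 2 * expNegInvGlue (1 - u') * (L * ((1 - u')⁻¹ ^ 5 / expNegInvGlue (1 - u'))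
          * (20 * η ^ 8)) := by gcongr; exact hdQ.trans (by gcongr)
      _ = 40 * L * ((1 - u')⁻¹ ^ 5 * η ^ 8) := by
          field_simp
          ring
      _ ≤ 40 * L * η := by gcongr
  have e : correction u v - correction u' v' = (profile v - profile v') * chordRatio u
      + profile v' * (chordRatio u - chordRatio u') := by
    simp only [correction]
    ring
  rw [e]
  calc _ ≤ |profile v - profile v'| * |chordRatio u|
        + |profile v'| * |chordRatio u - chordRatio u'| := by
        rw [← abs_mul, ← abs_mul]
        exact abs_add_le _ _
    _ ≤ _ := by linarith

theorem exists_abs_correction_sub_le : ∃ C : ℝ, ∀ η u u' v v' : ℝ, 0 ≤ η → η ≤ 1 → 0 ≤ u →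
    0 ≤ u' → u ≤ v → u' ≤ v' → |u - u'| ≤ 20 * η ^ 8 → |v - v'| ≤ 20 * η ^ 8 →
    |correction u v - correction u' v'| ≤ C * η := by
  obtain ⟨C, hC⟩ := exists_abs_correction_sub_le_of_le
  refine ⟨C, fun η u u' v v' hη hη1 hu hu' huv huv' hdu hdv ↦ ?_⟩
  rcases le_total u u' with h | h
  · exact hC η u u' v v' hη hη1 hu h huv huv' hdu hdv
  · rw [abs_sub_comm]
    exact hC η u' u v' v hη hη1 hu' h huv' huv (abs_sub_comm u u' ▸ hdu) (abs_sub_comm v v' ▸ hdv)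

/-- Continuity where `q.1 ^ 2 ≥ 1` comes from squeezing by `abs_correction_le`; elsewhere the ratio
is smooth. -/
theorem continuous_correction : Continuous fun q : ℝ × ℝ ↦
    correction (q.1 ^ 2) (q.1 ^ 2 + q.2 ^ 2) := by
  refine continuous_iff_continuousAt.2 fun q ↦ ?_
  rcases lt_or_ge (q.1 ^ 2) 1 with h | h
  · have h1 : ContinuousAt (fun q : ℝ × ℝ ↦ chordRatio (q.1 ^ 2)) q :=
      ContinuousAt.comp (f := fun q : ℝ × ℝ ↦ q.1 ^ 2)
        (contDiffAt_chordRatio (sq_nonneg _) h.ne).continuousAt (by fun_prop)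
    have h2 := continuous_profile
    exact ContinuousAt.mul (by fun_prop) h1
  · have h0 : correction (q.1 ^ 2) (q.1 ^ 2 + q.2 ^ 2) = 0 := by
      rw [correction, chordRatio_of_one_le h, mul_zero]
    rw [ContinuousAt, h0]
    refine squeeze_zero_norm (a := fun q : ℝ × ℝ ↦ max (1 - q.1 ^ 2) 0 / 2)
      (fun p ↦ abs_correction_le (sq_nonneg _) (by nlinarith [sq_nonneg p.2])) ?_
    have hc : Continuous fun q : ℝ × ℝ ↦ max (1 - q.1 ^ 2) 0 / 2 := by fun_prop
    convert hc.tendsto q using 2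
    rw [max_eq_right (by linarith), zero_div]

/-! ### The weight on `Ω` -/

variable {d : ℕ}

theorem r_sq (p : Om d) : r p ^ 2 = ‖p.1‖ ^ 2 - ⟪p.1, (p.2 : E d)⟫ ^ 2 := by
  have hθ : ‖(p.2 : E d)‖ = 1 := norm_eq_of_mem_sphere p.2
  rw [r, norm_sub_sq_real, inner_smul_right, norm_smul, hθ, Real.norm_eq_abs, mul_one, sq_abs]
  ring

theorem r_sq_le (p : Om d) : r p ^ 2 ≤ ‖p.1‖ ^ 2 := by
  rw [r_sq]
  linarith [sq_nonneg ⟪p.1, (p.2 : E d)⟫]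

/-- The weight annihilating the radial function `x ↦ profile (|x|²)`. -/
noncomputable def radialWeight (p : Om d) : ℝ := 1 - correction (r p ^ 2) (‖p.1‖ ^ 2)

theorem radialWeight_eq (p : Om d) : radialWeight p =
    1 - correction (r p ^ 2) (r p ^ 2 + ⟪p.1, (p.2 : E d)⟫ ^ 2) := by
  rw [radialWeight, r_sq, sub_add_cancel]

theorem abs_correction_le_half {u v : ℝ} (hu : 0 ≤ u) (huv : u ≤ v) :
    |correction u v| ≤ 1 / 2 := by
  refine (abs_correction_le hu huv).trans ?_
  have : max (1 - u) 0 ≤ 1 := max_le (by linarith) zero_le_one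
  linarith

theorem half_le_radialWeight (p : Om d) : 1 / 2 ≤ radialWeight p := by
  have := abs_le.1 (abs_correction_le_half (sq_nonneg (r p)) (r_sq_le p))
  rw [radialWeight]
  linarith [this.2]

theorem abs_radialWeight_le (p : Om d) : |radialWeight p| ≤ 3 / 2 := by
  have := abs_le.1 (abs_correction_le_half (sq_nonneg (r p)) (r_sq_le p))
  rw [radialWeight, abs_le]
  constructor <;> linarith [this.1, this.2]

theorem radialWeight_of_one_le_r {p : Om d} (hp : 1 ≤ r p) : radialWeight p = 1 := by
  rw [radialWeight, correction, chordRatio_of_one_le (one_le_pow₀ hp), mul_zero, sub_zero]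

theorem radialWeight_of_one_le_norm {p : Om d} (hp : 1 ≤ ‖p.1‖) : radialWeight p = 1 := by
  rw [radialWeight, correction, profile_of_one_le (one_le_pow₀ hp), zero_mul, sub_zero]

theorem isRotationInvariant_radialWeight : IsRotationInvariant (radialWeight (d := d)) := by
  refine ⟨fun q ↦ 1 - correction (q.1 ^ 2) (q.1 ^ 2 + q.2 ^ 2),
    continuous_const.sub continuous_correction, fun q ↦ ?_, fun a b ↦ ?_, radialWeight_eq⟩
  · have := abs_le.1 (abs_correction_le_half (sq_nonneg q.1)
      (by nlinarith [sq_nonneg q.2] : q.1 ^ 2 ≤ q.1 ^ 2 + q.2 ^ 2))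
    linarith [this.2]
  · simp only [neg_sq, and_self]

theorem continuous_radialWeight : Continuous (radialWeight (d := d)) := by
  have h : Continuous fun p : Om d ↦ (r p, ⟪p.1, (p.2 : E d)⟫) := by
    unfold r
    fun_prop
  rw [show radialWeight (d := d) = _ from funext radialWeight_eq]
  have hc : Continuous fun p : Om d ↦
      correction (r p ^ 2) (r p ^ 2 + ⟪p.1, (p.2 : E d)⟫ ^ 2) :=
    Continuous.comp (g := fun q : ℝ × ℝ ↦ correction (q.1 ^ 2) (q.1 ^ 2 + q.2 ^ 2))
      (f := fun p : Om d ↦ (r p, ⟪p.1, (p.2 : E d)⟫)) continuous_correction h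
  exact continuous_const.sub hc

theorem isWeight_radialWeight : IsWeight (radialWeight (d := d)) :=
  ⟨⟨1 / 2, by norm_num, half_le_radialWeight⟩,
    memLp_top_of_bound continuous_radialWeight.aestronglyMeasurable (3 / 2)
      (Filter.Eventually.of_forall abs_radialWeight_le)⟩

theorem isSmoothOn_radialWeight (hd : 2 ≤ d) :
    IsSmoothOn hd (radialWeight (d := d)) (OmSet d {1})ᶜ := by
  have := fact_finrank hd
  intro p hp
  have hx : ContMDiff (𝓘(ℝ, E d).prod (𝓡 (d - 1))) 𝓘(ℝ, E d) ∞ fun p : Om d ↦ p.1 :=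
    contMDiff_fst
  have hθ : ContMDiff (𝓘(ℝ, E d).prod (𝓡 (d - 1))) 𝓘(ℝ, E d) ∞ fun p : Om d ↦ (p.2 : E d) :=
    contMDiff_coe_sphere.comp contMDiff_snd
  have hs : ContDiff ℝ ∞ fun q : E d × E d ↦ ‖q.1‖ ^ 2 - ⟪q.1, q.2⟫ ^ 2 :=
    (contDiff_fst.norm_sq ℝ).sub ((contDiff_fst.inner ℝ contDiff_snd).pow 2)
  have hu : ContMDiff (𝓘(ℝ, E d).prod (𝓡 (d - 1))) 𝓘(ℝ, ℝ) ∞ fun p : Om d ↦ r p ^ 2 := by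
    simp only [r_sq]
    exact ContMDiff.comp (g := fun q : E d × E d ↦ ‖q.1‖ ^ 2 - ⟪q.1, q.2⟫ ^ 2)
      (f := fun p : Om d ↦ (p.1, (p.2 : E d))) hs.contMDiff (hx.prodMk_space hθ)
  have hv : ContMDiff (𝓘(ℝ, E d).prod (𝓡 (d - 1))) 𝓘(ℝ, ℝ) ∞ fun p : Om d ↦ ‖p.1‖ ^ 2 :=
    ContMDiff.comp (g := fun x : E d ↦ ‖x‖ ^ 2) (f := fun p : Om d ↦ p.1)
      (contDiff_id.norm_sq ℝ).contMDiff hx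
  have hr : r p ^ 2 ≠ 1 := fun h ↦ hp
    ((pow_eq_one_iff_of_nonneg (show 0 ≤ r p from norm_nonneg _) two_ne_zero).1 h)
  have hQ : ContDiffAt ℝ ∞ (fun q : ℝ × ℝ ↦ chordRatio q.1) (r p ^ 2, ‖p.1‖ ^ 2) :=
    ContDiffAt.comp (g := chordRatio) (f := fun q : ℝ × ℝ ↦ q.1) (r p ^ 2, ‖p.1‖ ^ 2)
      (contDiffAt_chordRatio (sq_nonneg (r p)) hr) contDiffAt_fst
  have hcorr : ContDiffAt ℝ ∞ (fun q : ℝ × ℝ ↦ 1 - correction q.1 q.2) (r p ^ 2, ‖p.1‖ ^ 2) :=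
    contDiffAt_const.sub ((contDiff_profile.comp contDiff_snd).contDiffAt.mul hQ)
  exact (ContMDiffAt.comp (g := fun q : ℝ × ℝ ↦ 1 - correction q.1 q.2)
    (f := fun p : Om d ↦ (r p ^ 2, ‖p.1‖ ^ 2)) p hcorr.contMDiffAt
    (hu.prodMk_space hv).contMDiffAt).contMDiffWithinAt

/-- The squares `r²` and `|x|²` are Lipschitz on bounded sets, so the bound for the correction
applies with `η = δ ^ (1/8)`. -/
theorem exists_abs_radialWeight_sub_le : ∃ C : ℝ, 0 ≤ C ∧ ∀ p q : Om d, eucDist p q ≤ 1 →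
    |radialWeight p - radialWeight q| ≤ C * eucDist p q ^ (1 / 8 : ℝ) := by
  obtain ⟨C, hC⟩ := exists_abs_correction_sub_le
  refine ⟨|C|, abs_nonneg C, fun p q hpq ↦ ?_⟩
  have hδ0 : 0 ≤ eucDist p q := Real.sqrt_nonneg _
  have hx : ‖p.1 - q.1‖ ≤ eucDist p q :=
    Real.le_sqrt_of_sq_le (by linarith [sq_nonneg ‖(p.2 : E d) - (q.2 : E d)‖])
  have hθ : ‖(p.2 : E d) - (q.2 : E d)‖ ≤ eucDist p q :=
    Real.le_sqrt_of_sq_le (by linarith [sq_nonneg ‖p.1 - q.1‖])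
  set δ := eucDist p q
  -- If both points lie outside the unit ball the weights agree; otherwise both norms are at most 2,
  -- which makes the Lipschitz constants uniform.
  by_cases hfar : 1 ≤ ‖p.1‖ ∧ 1 ≤ ‖q.1‖
  · rw [radialWeight_of_one_le_norm hfar.1, radialWeight_of_one_le_norm hfar.2, sub_self, abs_zero]
    positivity
  have hxy := abs_le.1 ((abs_norm_sub_norm_le p.1 q.1).trans hx)
  obtain ⟨hp2, hq2⟩ : ‖p.1‖ ≤ 2 ∧ ‖q.1‖ ≤ 2 := by
    rw [not_and_or, not_le, not_le] at hfar
    rcases hfar with h | h <;> constructor <;> linarith [hxy.1, hxy.2]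
  have hp1 : ‖(p.2 : E d)‖ = 1 := norm_eq_of_mem_sphere p.2
  have hq1 : ‖(q.2 : E d)‖ = 1 := norm_eq_of_mem_sphere q.2
  have hv : |‖p.1‖ ^ 2 - ‖q.1‖ ^ 2| ≤ 4 * δ := by
    rw [sq_sub_sq, abs_mul, abs_of_nonneg (by positivity)]
    exact mul_le_mul (by linarith) (abs_le.2 hxy) (abs_nonneg _) (by norm_num)
  have hs : |⟪p.1, (p.2 : E d)⟫ - ⟪q.1, (q.2 : E d)⟫| ≤ 3 * δ := by
    have e : ⟪p.1, (p.2 : E d)⟫ - ⟪q.1, (q.2 : E d)⟫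
        = ⟪p.1 - q.1, (p.2 : E d)⟫ + ⟪q.1, (p.2 : E d) - (q.2 : E d)⟫ := by
      rw [inner_sub_left, inner_sub_right]
      ring
    rw [e]
    calc _ ≤ ‖p.1 - q.1‖ * ‖(p.2 : E d)‖ + ‖q.1‖ * ‖(p.2 : E d) - (q.2 : E d)‖ :=
          (abs_add_le _ _).trans
            (add_le_add (abs_real_inner_le_norm _ _) (abs_real_inner_le_norm _ _))
      _ ≤ δ * 1 + 2 * δ := by
          rw [hp1]
          gcongr
      _ = 3 * δ := by ring
  have hsp : |⟪p.1, (p.2 : E d)⟫| ≤ 2 :=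
    (abs_real_inner_le_norm _ _).trans (by rw [hp1]; linarith)
  have hsq : |⟪q.1, (q.2 : E d)⟫| ≤ 2 :=
    (abs_real_inner_le_norm _ _).trans (by rw [hq1]; linarith)
  have hs2 : |⟪p.1, (p.2 : E d)⟫ ^ 2 - ⟪q.1, (q.2 : E d)⟫ ^ 2| ≤ 12 * δ := by
    rw [sq_sub_sq, abs_mul]
    calc _ ≤ (2 + 2) * (3 * δ) := by
          gcongr
          exact (abs_add_le _ _).trans (add_le_add hsp hsq)
      _ = 12 * δ := by ring
  have hη8 : (δ ^ (1 / 8 : ℝ)) ^ 8 = δ := by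
    rw [← Real.rpow_natCast, ← Real.rpow_mul hδ0]
    norm_num
  have hmain := hC (δ ^ (1 / 8 : ℝ)) (r p ^ 2) (r q ^ 2) (‖p.1‖ ^ 2) (‖q.1‖ ^ 2) (by positivity)
    (Real.rpow_le_one hδ0 hpq (by norm_num)) (sq_nonneg _) (sq_nonneg _) (r_sq_le p) (r_sq_le q)
    (by
      rw [hη8, r_sq, r_sq]
      rw [abs_le] at *
      constructor <;> linarith [hv.1, hv.2, hs2.1, hs2.2])
    (by
      rw [hη8]
      linarith)
  rw [radialWeight, radialWeight, sub_sub_sub_cancel_left, abs_sub_comm]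
  exact hmain.trans (mul_le_mul_of_nonneg_right (le_abs_self C) (by positivity))

theorem isHolder_radialWeight {α : ℝ} (h0 : 0 < α) (h1 : α ≤ 1 / 8) :
    IsHolder α (radialWeight (d := d)) := by
  obtain ⟨C, hC0, hC⟩ := exists_abs_radialWeight_sub_le (d := d)
  refine ⟨⟨3 / 2, abs_radialWeight_le⟩, C, fun p q hpq ↦ (hC p q hpq).trans ?_⟩
  exact mul_le_mul_of_nonneg_left
    (Real.rpow_le_rpow_of_exponent_ge' (Real.sqrt_nonneg _) hpq h0.le h1) hC0

/-! ### The annihilated function and its ray transform -/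

/-- The radial function `x ↦ profile (|x|²)`. -/
noncomputable def radialFun (x : E d) : ℝ := profile (‖x‖ ^ 2)

theorem contDiff_radialFun : ContDiff ℝ ∞ (radialFun (d := d)) :=
  contDiff_profile.comp (contDiff_id.norm_sq ℝ)

theorem tsupport_radialFun_subset :
    tsupport (radialFun (d := d)) ⊆ closedBall (0 : E d) 1 := by
  refine closure_minimal (fun x hx ↦ ?_) isClosed_closedBall
  rw [mem_closedBall_zero_iff]
  by_contra! h
  exact hx (profile_of_one_le (one_le_pow₀ h.le))

theorem radialFun_ne_zero (hd : 2 ≤ d) : radialFun (d := d) ≠ 0 := by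
  intro h0
  have hpos := chordIntegral_profile_sq_pos le_rfl zero_lt_one
  have hz : ∀ t : ℝ, profile (0 + t ^ 2) = 0 := fun t ↦ by
    have := congr_fun h0 (EuclideanSpace.single ⟨0, by omega⟩ t)
    simpa [radialFun] using this
  simp only [chordIntegral, hz] at hpos
  simp at hpos

/-- For `u ≥ 0` the integrand vanishes once `|t| ≥ 1`, so the fixed window `[-2, 2]` loses nothing
and needs no dependence on `u`. -/
theorem integral_eq_chordIntegral {k : ℝ → ℝ} (hk : ∀ v, 1 ≤ v → k v = 0) {u : ℝ} (hu : 0 ≤ u) :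
    ∫ t : ℝ, k (u + t ^ 2) = chordIntegral k u := by
  refine (intervalIntegral.integral_eq_integral_of_support_subset fun t ht ↦ ?_).symm
  have h1 : u + t ^ 2 < 1 := by
    by_contra! h
    exact ht (hk _ h)
  constructor <;> nlinarith

theorem rayTransform_radialWeight_radialFun {p : Om d} (hp : p ∈ TS d) :
    rayTransform radialWeight radialFun p = 0 := by
  have hθ : ‖(p.2 : E d)‖ = 1 := norm_eq_of_mem_sphere p.2
  have hp0 : ⟪p.1, (p.2 : E d)⟫ = 0 := hp
  set u := ‖p.1‖ ^ 2 with hu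
  have hu0 : 0 ≤ u := sq_nonneg _
  have hn : ∀ t : ℝ, ‖p.1 + t • (p.2 : E d)‖ ^ 2 = u + t ^ 2 := fun t ↦ by
    rw [norm_add_sq_real, inner_smul_right, hp0, norm_smul, hθ, Real.norm_eq_abs, mul_one, sq_abs,
      ← hu]
    ring
  have hr : ∀ t : ℝ, r (p.1 + t • (p.2 : E d), p.2) ^ 2 = u := fun t ↦ by
    rw [r_sq, hn, inner_add_left, hp0, inner_smul_left, real_inner_self_eq_norm_sq, hθ]
    simp
  have hint : ∀ t : ℝ, radialWeight (p.1 + t • (p.2 : E d), p.2) * radialFun (p.1 + t • (p.2 : E d))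
      = (fun v ↦ profile v - chordRatio u * profile v ^ 2) (u + t ^ 2) := fun t ↦ by
    simp only [radialWeight, radialFun, correction, hr, hn]
    ring
  rw [rayTransform]
  simp only [hint]
  rw [integral_eq_chordIntegral (k := fun v ↦ profile v - chordRatio u * profile v ^ 2)
    (fun v hv ↦ by simp [profile_of_one_le hv]) hu0, chordIntegral,
    intervalIntegral.integral_sub, intervalIntegral.integral_const_mul]
  · change chordIntegral profile u - chordRatio u * chordIntegral (fun v ↦ profile v ^ 2) u = 0
    -- Inside, `F - (F / H) H = 0` because `H > 0`; for `u ≥ 1` the line misses the open unit ball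
    -- and both terms vanish.
    rcases lt_or_ge u 1 with h | h
    · rw [chordRatio, div_mul_cancel₀ _ (chordIntegral_profile_sq_pos hu0 h).ne', sub_self]
    · rw [chordIntegral_profile_of_one_le h, chordRatio_of_one_le h, zero_mul, sub_zero]
  all_goals
    have := continuous_profile
    exact Continuous.intervalIntegrable (by fun_prop) _ _

end WeightedRay

theorem theorem1 (d : ℕ) (hd : 2 ≤ d) :
    ∃ (W : WeightedRay.Om d → ℝ) (f : WeightedRay.E d → ℝ),
      WeightedRay.IsWeight W ∧
      ContDiff ℝ ∞ f ∧ HasCompactSupport f ∧ f ≠ 0 ∧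
      (∀ p ∈ WeightedRay.TS d, WeightedRay.rayTransform W f p = 0) ∧
      WeightedRay.IsRotationInvariant W ∧
      WeightedRay.IsSphericallySymmetric f ∧
      tsupport f ⊆ closedBall (0 : WeightedRay.E d) 1 ∧
      WeightedRay.IsSmoothOn hd W (WeightedRay.OmSet d {1})ᶜ ∧
      (∀ α : ℝ, 0 < α → α < 1 / 16 → WeightedRay.IsHolder α W) ∧
      (∀ p, 1 / 2 ≤ W p) ∧
      (∀ p ∈ WeightedRay.OmSet d (Set.Ici 1), W p = 1) ∧
      ∃ R : ℝ, 1 < R ∧ ∀ p : WeightedRay.Om d, R ≤ ‖p.1‖ → W p = 1 :=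
  ⟨WeightedRay.radialWeight, WeightedRay.radialFun, WeightedRay.isWeight_radialWeight,
    WeightedRay.contDiff_radialFun,
    (isCompact_closedBall _ _).of_isClosed_subset (isClosed_tsupport _)
      WeightedRay.tsupport_radialFun_subset,
    WeightedRay.radialFun_ne_zero hd,
    fun _ hp ↦ WeightedRay.rayTransform_radialWeight_radialFun hp,
    WeightedRay.isRotationInvariant_radialWeight,
    ⟨fun s ↦ WeightedRay.profile (s ^ 2), fun _ ↦ rfl⟩,
    WeightedRay.tsupport_radialFun_subset,
    WeightedRay.isSmoothOn_radialWeight hd,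
    fun _ h0 h1 ↦ WeightedRay.isHolder_radialWeight h0 (by linarith),
    WeightedRay.half_le_radialWeight,
    fun _ hp ↦ WeightedRay.radialWeight_of_one_le_r hp,
    2, by norm_num, fun _ hp ↦ WeightedRay.radialWeight_of_one_le_norm (by linarith)⟩
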